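/- Let $k\in\mathbb{N}$ be fixed and let $\mu$ be the standard Gaussian measure on $\mathbb{R}^k$. For $n\ge 1$ let $\bar\sigma_n$ be the uniform (orthogonally invariant) Borel probability measure on the sphere $S^{n-1}(\sqrt n)=\{x\in\mathbb{R}^n:\|x\|=\sqrt n\}$. For $n\ge k$, a function $g$ on $\mathbb{R}^k$ is regarded as the function $x\mapsto g(x_1,\dots,x_k)$ on $\mathbb{R}^n$. Theorem. For each real $p>1$ there is a constant $C_p>0$ (which may also depend on the fixed $k$) such that, with $q>0$ defined by $\frac1p+\frac1q=1$, every $g\in L^p(\mathbb{R}^k,\mu)$ and every $n\in\mathbb{N}$ with $n>4(k+2)q$ satisfy: $|g|$ is $\bar\sigma_n$-integrable on $S^{n-1}(\sqrt n)$, and $$\int_{S^{n-1}(\sqrt n)} |g|\,d\bar\sigma_n\;\le\; C_p\,\big[\mathbb{E}_\mu(|g|^p)\big]^{1/p}.$$ -/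

import Mathlib

open MeasureTheory ProbabilityTheory
open scoped ENNReal Pointwise

noncomputable section

/-- The dilation from the unit sphere of `ℝⁿ` to the sphere `Sⁿ⁻¹(√n)` of radius `√n`
centred at the origin. -/
def sphereDilation (n : ℕ) (u : Metric.sphere (0 : EuclideanSpace ℝ (Fin n)) 1) :
    Metric.sphere (0 : EuclideanSpace ℝ (Fin n)) (√(n : ℝ)) :=
  ⟨√(n : ℝ) • (u : EuclideanSpace ℝ (Fin n)), by
    have hu : ‖(u : EuclideanSpace ℝ (Fin n))‖ = 1 := by simp
    simp [norm_smul, abs_of_nonneg (Real.sqrt_nonneg _)]⟩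

/-- The uniform probability measure on the Borel sets of the sphere `Sⁿ⁻¹(√n)` (for `n ≥ 1`):
the image, under dilation by `√n`, of the normalised surface area measure of the unit sphere.
Mathlib's `toSphere` is the surface area measure of the unit sphere given by the volume-of-cone
formula. The two lemmas below show that this is a probability measure that is invariant under all
orthogonal transformations. -/
def uniformSphere (n : ℕ) :
    Measure (Metric.sphere (0 : EuclideanSpace ℝ (Fin n)) (√(n : ℝ))) :=
  (((volume : Measure (EuclideanSpace ℝ (Fin n))).toSphere Set.univ)⁻¹ •
    (volume : Measure (EuclideanSpace ℝ (Fin n))).toSphere).map (sphereDilation n)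

/-- The projection `ℝⁿ → ℝᵏ` onto the first `k` coordinates, for `k ≤ n`. -/
def firstCoords {k n : ℕ} (h : k ≤ n) (x : EuclideanSpace ℝ (Fin n)) :
    EuclideanSpace ℝ (Fin k) :=
  WithLp.toLp 2 (fun i => x (Fin.castLE h i))

lemma measurable_sphereDilation (n : ℕ) : Measurable (sphereDilation n) := by
  unfold sphereDilation
  fun_prop

lemma isProbabilityMeasure_uniformSphere (n : ℕ) (hn : n ≠ 0) :
    IsProbabilityMeasure (uniformSphere n) := by
  haveI : Nonempty (Fin n) := ⟨⟨0, Nat.pos_of_ne_zero hn⟩⟩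
  refine ⟨?_⟩
  rw [uniformSphere, Measure.map_apply (measurable_sphereDilation n) MeasurableSet.univ,
    Set.preimage_univ, Measure.smul_apply, smul_eq_mul]
  refine ENNReal.inv_mul_cancel ?_ (measure_ne_top _ _)
  rw [Ne, Measure.measure_univ_eq_zero]
  exact Measure.toSphere_ne_zero _

/-- The action of an orthogonal transformation on the sphere of radius `r`. -/
def sphereRotation {n : ℕ} (r : ℝ)
    (R : EuclideanSpace ℝ (Fin n) ≃ₗᵢ[ℝ] EuclideanSpace ℝ (Fin n))
    (x : Metric.sphere (0 : EuclideanSpace ℝ (Fin n)) r) :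
    Metric.sphere (0 : EuclideanSpace ℝ (Fin n)) r :=
  ⟨R x, by simp⟩

lemma measurable_sphereRotation {n : ℕ} (r : ℝ)
    (R : EuclideanSpace ℝ (Fin n) ≃ₗᵢ[ℝ] EuclideanSpace ℝ (Fin n)) :
    Measurable (sphereRotation r R) := by
  unfold sphereRotation
  fun_prop

lemma map_sphereRotation_uniformSphere (n : ℕ)
    (R : EuclideanSpace ℝ (Fin n) ≃ₗᵢ[ℝ] EuclideanSpace ℝ (Fin n)) :
    (uniformSphere n).map (sphereRotation (√(n : ℝ)) R) = uniformSphere n := by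
  have hcomm : sphereRotation (√(n : ℝ)) R ∘ sphereDilation n =
      sphereDilation n ∘ sphereRotation 1 R := by
    funext u
    apply Subtype.ext
    simp [sphereRotation, sphereDilation]
  have hrot : ((volume : Measure (EuclideanSpace ℝ (Fin n))).toSphere).map (sphereRotation 1 R) =
      (volume : Measure (EuclideanSpace ℝ (Fin n))).toSphere := by
    ext s hs
    rw [Measure.map_apply (measurable_sphereRotation 1 R) hs,
      Measure.toSphere_apply' _ (measurable_sphereRotation 1 R hs), Measure.toSphere_apply' _ hs]
    congr 1
    have hset : Set.Ioo (0 : ℝ) 1 • ((↑) '' (sphereRotation 1 R ⁻¹' s)) =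
        R ⁻¹' (Set.Ioo (0 : ℝ) 1 • (((↑) : _ → EuclideanSpace ℝ (Fin n)) '' s)) := by
      ext x
      simp only [Set.mem_smul, Set.mem_image, Set.mem_preimage]
      constructor
      · rintro ⟨t, ht, _, ⟨u, hu, rfl⟩, rfl⟩
        exact ⟨t, ht, _, ⟨_, hu, rfl⟩, by simp [sphereRotation]⟩
      · rintro ⟨t, ht, _, ⟨u, hu, rfl⟩, hx⟩
        refine ⟨t, ht, _, ⟨sphereRotation 1 R.symm u, ?_, rfl⟩, ?_⟩
        · simpa [sphereRotation] using hu
        · apply R.injective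
          simpa [sphereRotation] using hx
    rw [hset]
    exact R.measurePreserving.measure_preimage_emb R.toHomeomorph.measurableEmbedding _
  rw [uniformSphere, Measure.map_map (measurable_sphereRotation _ R) (measurable_sphereDilation n),
    hcomm, ← Measure.map_map (measurable_sphereDilation n) (measurable_sphereRotation 1 R),
    Measure.map_smul, hrot]

end

/-!
The first `k` coordinates of a uniform point of the sphere `Sⁿ⁻¹(√n)` have a density on `ℝᵏ`
proportional to `(1 - ‖x‖² / n)₊ ^ ((n - k - 2) / 2)`. Since `1 - t ≤ exp (-t)`, this is at most
`exp (-‖x‖² / 2) * exp ((k + 2) ‖x‖² / (2 n))`, a multiple of the Gaussian density times a factor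
whose `q`-th power is at most `exp (‖x‖² / 8)` once `n > 4 (k + 2) q`. As `exp (‖x‖² / 8)` is
integrable for the Gaussian measure, Hölder's inequality gives the bound
(`lintegral_uniformSphere_le_Lp_stdGaussian`), provided that the normalising constant is bounded
uniformly in `n`; this holds because `(1 - ‖x‖² / n)₊ ^ ((n - k - 2) / 2) ≥ 1 / 2` on a fixed ball
(`half_volume_ball_le_lintegral_sphereMarginalWeight`).

The density is found (`lintegral_uniformSphere_mul`) by computing the integral over `ℝⁿ` of
`φ (√n x' / ‖x‖) h (‖x‖)`, where `x'` denotes the first `k` coordinates of `x`, in two ways: in polar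
coordinates of `ℝⁿ` (`lintegral_sphere_polar`), and by Tonelli's theorem with polar coordinates in the
last `n - k` variables (`lintegral_sphere_cylindrical`). The only nonlinear change of variables this
needs is the one-dimensional `s = √(b² + r²)`. The choice `φ = 1` then provides the normalising
constant, so that no explicit value of a sphere's area enters.
-/

/-! ### The standard Gaussian measure and Lebesgue measure -/

/-- The density of the standard Gaussian measure with respect to Lebesgue measure, written without
dividing by the normalising constant. The two sides have the same characteristic function. -/
theorem withDensity_exp_neg_sq_norm_eq_smul_stdGaussian (E : Type*) [NormedAddCommGroup E]
    [InnerProductSpace ℝ E] [FiniteDimensional ℝ E] [MeasurableSpace E] [BorelSpace E] :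
    (volume : Measure E).withDensity (fun x ↦ ENNReal.ofReal (Real.exp (-‖x‖ ^ 2 / 2))) =
      ENNReal.ofReal ((2 * Real.pi) ^ (Module.finrank ℝ E / 2 : ℝ)) • stdGaussian E := by
  have hint : Integrable (fun x : E ↦ Real.exp (-‖x‖ ^ 2 / 2)) := by
    -- A function that is not integrable would have integral `0` by convention.
    refine Integrable.of_integral_ne_zero ?_
    have h := GaussianFourier.integral_rexp_neg_mul_sq_norm (V := E) (b := 1 / 2) (by norm_num)
    have h' : (fun x : E ↦ Real.exp (-‖x‖ ^ 2 / 2)) =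
        fun x ↦ Real.exp (-(1 / 2) * ‖x‖ ^ 2) := by
      ext x; congr 1; ring
    rw [h', h]
    positivity
  have : IsFiniteMeasure
      ((volume : Measure E).withDensity (fun x ↦ ENNReal.ofReal (Real.exp (-‖x‖ ^ 2 / 2)))) :=
    isFiniteMeasure_withDensity_ofReal hint.2
  have : IsFiniteMeasure
      (ENNReal.ofReal ((2 * Real.pi) ^ (Module.finrank ℝ E / 2 : ℝ)) • stdGaussian E) :=
    Measure.smul_finite _ ENNReal.ofReal_ne_top
  apply Measure.ext_of_charFun
  ext t
  rw [charFun_apply, charFun_apply, integral_smul_measure, ← charFun_apply (μ := stdGaussian E),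
    charFun_stdGaussian,
    integral_withDensity_eq_integral_toReal_smul (by fun_prop) (by simp)]
  have h := GaussianFourier.integral_cexp_neg_mul_sq_norm_add (V := E) (b := 1 / 2) (by norm_num)
    Complex.I t
  have h' : ∀ x : E, (ENNReal.ofReal (Real.exp (-‖x‖ ^ 2 / 2))).toReal •
      Complex.exp (inner ℝ x t * Complex.I) =
      Complex.exp (-(1 / 2) * ‖x‖ ^ 2 + Complex.I * inner ℝ t x) := by
    intro x
    rw [ENNReal.toReal_ofReal (Real.exp_pos _).le, Complex.real_smul, Complex.ofReal_exp,
      ← Complex.exp_add, real_inner_comm]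
    congr 1
    push_cast
    ring
  simp_rw [h']
  rw [h, ENNReal.toReal_ofReal (by positivity), Complex.real_smul,
    Complex.ofReal_cpow (by positivity)]
  congr 2
  · push_cast; ring
  · push_cast; rfl
  · rw [Complex.I_sq]; ring

theorem lintegral_exp_sq_norm_stdGaussian_lt_top (E : Type*) [NormedAddCommGroup E]
    [InnerProductSpace ℝ E] [FiniteDimensional ℝ E] [MeasurableSpace E] [BorelSpace E]
    {a : ℝ} (ha : a < 1 / 2) :
    ∫⁻ x, ENNReal.ofReal (Real.exp (a * ‖x‖ ^ 2)) ∂(stdGaussian E) < ∞ := by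
  set D := ENNReal.ofReal ((2 * Real.pi) ^ (Module.finrank ℝ E / 2 : ℝ)) with hD
  have hD0 : D ≠ 0 := by
    rw [hD, ← pos_iff_ne_zero, ENNReal.ofReal_pos]
    positivity
  have hint : Integrable (fun x : E ↦ Real.exp (-(1 / 2 - a) * ‖x‖ ^ 2)) := by
    -- A function that is not integrable would have integral `0` by convention.
    refine Integrable.of_integral_ne_zero ?_
    have hb : 0 < 1 / 2 - a := by linarith
    rw [GaussianFourier.integral_rexp_neg_mul_sq_norm (V := E) hb]
    positivity
  have key : D * ∫⁻ x, ENNReal.ofReal (Real.exp (a * ‖x‖ ^ 2)) ∂(stdGaussian E) =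
      ∫⁻ x : E, ENNReal.ofReal (Real.exp (-(1 / 2 - a) * ‖x‖ ^ 2)) := by
    rw [← smul_eq_mul, ← lintegral_smul_measure, hD,
      ← withDensity_exp_neg_sq_norm_eq_smul_stdGaussian,
      lintegral_withDensity_eq_lintegral_mul _ (by fun_prop) (by fun_prop)]
    refine lintegral_congr fun x ↦ ?_
    rw [Pi.mul_apply, ← ENNReal.ofReal_mul (Real.exp_pos _).le, ← Real.exp_add]
    congr 2
    ring
  have hlt : D * ∫⁻ x, ENNReal.ofReal (Real.exp (a * ‖x‖ ^ 2)) ∂(stdGaussian E) < ∞ := by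
    rw [key]
    exact hint.lintegral_lt_top
  exact ENNReal.lt_top_of_mul_ne_top_right hlt.ne hD0

/-! ### Polar coordinates -/

/-- Integration in polar coordinates for nonnegative functions. -/
theorem lintegral_eq_lintegral_toSphere_lintegral_Ioi {E : Type*} [NormedAddCommGroup E]
    [NormedSpace ℝ E] [Nontrivial E] [FiniteDimensional ℝ E] [MeasurableSpace E] [BorelSpace E]
    (μ : Measure E) [μ.IsAddHaarMeasure] {f : E → ℝ≥0∞} (hf : Measurable f) :
    ∫⁻ x, f x ∂μ = ∫⁻ u, (∫⁻ r in Set.Ioi (0 : ℝ),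
      ENNReal.ofReal (r ^ (Module.finrank ℝ E - 1)) * f (r • (u : E))) ∂μ.toSphere := by
  have hg : Measurable fun p : Metric.sphere (0 : E) 1 × Set.Ioi (0 : ℝ) ↦
      f ((p.2 : ℝ) • (p.1 : E)) := by fun_prop
  calc
    ∫⁻ x, f x ∂μ = ∫⁻ x : ({(0)}ᶜ : Set E), f x ∂(μ.comap (↑)) := by
      rw [lintegral_subtype_comap (measurableSet_singleton _).compl, restrict_compl_singleton]
    _ = ∫⁻ p, f ((p.2 : ℝ) • (p.1 : E))
          ∂(μ.toSphere.prod (.volumeIoiPow (Module.finrank ℝ E - 1))) := by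
      rw [← μ.measurePreserving_homeomorphUnitSphereProd.lintegral_comp hg]
      refine lintegral_congr fun x ↦ ?_
      have hx : ‖(x : E)‖ ≠ 0 := norm_ne_zero_iff.2 x.2
      simp [smul_smul, hx]
    _ = _ := by
      rw [lintegral_prod _ hg.aemeasurable]
      refine lintegral_congr fun u ↦ ?_
      rw [Measure.volumeIoiPow, lintegral_withDensity_eq_lintegral_mul _ (by fun_prop)
        (by fun_prop)]
      exact lintegral_subtype_comap measurableSet_Ioi
        fun r : ℝ ↦ ENNReal.ofReal (r ^ (Module.finrank ℝ E - 1)) * f (r • (u : E))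

theorem lintegral_fun_norm_eq_toSphere_univ_mul {E : Type*} [NormedAddCommGroup E]
    [NormedSpace ℝ E] [Nontrivial E] [FiniteDimensional ℝ E] [MeasurableSpace E] [BorelSpace E]
    (μ : Measure E) [μ.IsAddHaarMeasure] {f : ℝ → ℝ≥0∞} (hf : Measurable f) :
    ∫⁻ x, f ‖x‖ ∂μ = μ.toSphere Set.univ *
      ∫⁻ r in Set.Ioi (0 : ℝ), ENNReal.ofReal (r ^ (Module.finrank ℝ E - 1)) * f r := by
  rw [lintegral_eq_lintegral_toSphere_lintegral_Ioi μ (by fun_prop)]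
  have h : ∀ u : Metric.sphere (0 : E) 1, ∫⁻ r in Set.Ioi (0 : ℝ),
      ENNReal.ofReal (r ^ (Module.finrank ℝ E - 1)) * f ‖r • (u : E)‖ =
      ∫⁻ r in Set.Ioi (0 : ℝ), ENNReal.ofReal (r ^ (Module.finrank ℝ E - 1)) * f r := by
    intro u
    refine setLIntegral_congr_fun measurableSet_Ioi fun r hr ↦ ?_
    simp [norm_smul, abs_of_pos (Set.mem_Ioi.1 hr)]
  simp_rw [h]
  rw [lintegral_const, mul_comm]

theorem lintegral_comp_smul_of_pos {E : Type*} [NormedAddCommGroup E]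
    [NormedSpace ℝ E] [FiniteDimensional ℝ E] [MeasurableSpace E] [BorelSpace E]
    (μ : Measure E) [μ.IsAddHaarMeasure] {a : ℝ} (ha : 0 < a) {f : E → ℝ≥0∞}
    (hf : Measurable f) :
    ∫⁻ x, f (a • x) ∂μ = ENNReal.ofReal ((a ^ Module.finrank ℝ E)⁻¹) * ∫⁻ x, f x ∂μ := by
  rw [← lintegral_map hf (measurable_const_smul a), Measure.map_addHaar_smul μ ha.ne',
    lintegral_smul_measure, abs_of_pos (by positivity), smul_eq_mul]

/-- The substitution `s = √(b² + r²)`, `r dr = s ds`. The integral on the right effectively runs over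
`s > b`: for `s ≤ b` the square root is `0` by convention, and so is its `m`-th power since `m ≠ 0`. -/
theorem lintegral_Ioi_comp_sqrt_sq_add_sq {b : ℝ} (hb : 0 ≤ b) {m : ℕ} (hm : m ≠ 0)
    (ψ : ℝ → ℝ≥0∞) :
    ∫⁻ r in Set.Ioi (0 : ℝ), ENNReal.ofReal (r ^ (m + 1)) * ψ √(b ^ 2 + r ^ 2) =
      ∫⁻ s in Set.Ioi (0 : ℝ), ENNReal.ofReal (s * √(s ^ 2 - b ^ 2) ^ m) * ψ s := by
  have himg : (fun r : ℝ ↦ √(b ^ 2 + r ^ 2)) '' Set.Ioi 0 = Set.Ioi b := by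
    ext s
    simp only [Set.mem_image, Set.mem_Ioi]
    constructor
    · rintro ⟨r, hr, rfl⟩
      exact Real.lt_sqrt_of_sq_lt (by nlinarith)
    · intro hs
      have h : 0 < s ^ 2 - b ^ 2 := by nlinarith
      refine ⟨√(s ^ 2 - b ^ 2), Real.sqrt_pos.2 h, ?_⟩
      rw [Real.sq_sqrt h.le, add_sub_cancel, Real.sqrt_sq (hb.trans hs.le)]
  have hinj : Set.InjOn (fun r : ℝ ↦ √(b ^ 2 + r ^ 2)) (Set.Ioi 0) := by
    intro r hr r' hr' h
    rw [Set.mem_Ioi] at hr hr'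
    have h' := (Real.sqrt_inj (by positivity) (by positivity)).1 h
    nlinarith
  have hderiv : ∀ r ∈ Set.Ioi (0 : ℝ), HasDerivWithinAt (fun r : ℝ ↦ √(b ^ 2 + r ^ 2))
      (r / √(b ^ 2 + r ^ 2)) (Set.Ioi 0) r := by
    intro r hr
    rw [Set.mem_Ioi] at hr
    have h : HasDerivAt (fun r : ℝ ↦ b ^ 2 + r ^ 2) (2 * r) r := by
      simpa using (hasDerivAt_pow 2 r).const_add (b ^ 2)
    have h' := (h.sqrt (by positivity)).hasDerivWithinAt (s := Set.Ioi 0)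
    rwa [mul_div_mul_left _ _ two_ne_zero] at h'
  have h0 : ∫⁻ s in Set.Ioi (0 : ℝ), ENNReal.ofReal (s * √(s ^ 2 - b ^ 2) ^ m) * ψ s =
      ∫⁻ s in Set.Ioi b, ENNReal.ofReal (s * √(s ^ 2 - b ^ 2) ^ m) * ψ s := by
    rw [← lintegral_indicator measurableSet_Ioi, ← lintegral_indicator measurableSet_Ioi]
    refine lintegral_congr fun s ↦ ?_
    by_cases hs : b < s
    · simp [hs, hb.trans_lt hs]
    · by_cases hs' : 0 < s
      · have h : √(s ^ 2 - b ^ 2) = 0 :=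
          Real.sqrt_eq_zero_of_nonpos (by nlinarith [not_lt.1 hs])
        simp [hs, hs', h, hm]
      · simp [hs, hs']
  rw [h0, ← himg, lintegral_image_eq_lintegral_abs_deriv_mul measurableSet_Ioi hderiv hinj]
  refine setLIntegral_congr_fun measurableSet_Ioi fun r hr ↦ ?_
  rw [Set.mem_Ioi] at hr
  have hpos : 0 < √(b ^ 2 + r ^ 2) := Real.sqrt_pos.2 (by positivity)
  rw [← mul_assoc, ← ENNReal.ofReal_mul (abs_nonneg _), abs_of_pos (by positivity)]
  congr 2
  rw [Real.sq_sqrt (by positivity), add_sub_cancel_left, Real.sqrt_sq hr.le]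
  field_simp
  ring

/-! ### Splitting off the first coordinates -/

/-- The identification of `ℝᵏ × ℝᵈ` with `ℝᵏ⁺ᵈ` by concatenation of coordinates. -/
noncomputable def appendCoords {k d : ℕ}
    (x : EuclideanSpace ℝ (Fin k) × EuclideanSpace ℝ (Fin d)) : EuclideanSpace ℝ (Fin (k + d)) :=
  WithLp.toLp 2 (Fin.append x.1.ofLp x.2.ofLp)

theorem measurePreserving_appendCoords (k d : ℕ) :
    MeasurePreserving (appendCoords (k := k) (d := d)) := by
  have h := (LinearIsometryEquiv.measurePreserving
      (LinearIsometryEquiv.piLpCongrLeft 2 ℝ ℝ (finSumFinEquiv (m := k) (n := d)))).comp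
    ((PiLp.volume_preserving_toLp (Fin k ⊕ Fin d)).comp
      ((volume_measurePreserving_sumPiEquivProdPi_symm (fun _ : Fin k ⊕ Fin d ↦ ℝ)).comp
        ((PiLp.volume_preserving_ofLp (Fin k)).prod (PiLp.volume_preserving_ofLp (Fin d)))))
  convert! h using 1
  ext x i
  refine Fin.addCases (fun j ↦ ?_) (fun j ↦ ?_) i <;>
    simp [appendCoords, MeasurableEquiv.coe_sumPiEquivProdPi_symm, Equiv.sumPiEquivProdPi]

theorem norm_appendCoords {k d : ℕ} (y : EuclideanSpace ℝ (Fin k)) (z : EuclideanSpace ℝ (Fin d)) :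
    ‖appendCoords (y, z)‖ = √(‖y‖ ^ 2 + ‖z‖ ^ 2) := by
  rw [EuclideanSpace.norm_eq, EuclideanSpace.norm_sq_eq, EuclideanSpace.norm_sq_eq,
    Fin.sum_univ_add]
  simp [appendCoords]

theorem firstCoords_appendCoords {k d : ℕ} (h : k ≤ k + d) (y : EuclideanSpace ℝ (Fin k))
    (z : EuclideanSpace ℝ (Fin d)) : firstCoords h (appendCoords (y, z)) = y := by
  ext i
  exact Fin.append_left y.ofLp z.ofLp i

theorem measurable_firstCoords {k n : ℕ} (h : k ≤ n) : Measurable (firstCoords h) := by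
  unfold firstCoords
  fun_prop

theorem firstCoords_smul {k n : ℕ} (h : k ≤ n) (a : ℝ) (x : EuclideanSpace ℝ (Fin n)) :
    firstCoords h (a • x) = a • firstCoords h x := rfl

/-! ### The law of the first coordinates on the sphere -/

/-- The density on `ℝᵏ`, up to a constant factor, of the first `k` coordinates of a uniform point of
`Sⁿ⁻¹(√n)`, where `n = k + m + 2`, namely `(1 - ‖x‖² / n)₊ ^ (m / 2)`. As `√` is `0` on negative
numbers, the positive part need not be written when `m ≠ 0`. -/
noncomputable def sphereMarginalWeight (k m : ℕ) (x : EuclideanSpace ℝ (Fin k)) : ℝ≥0∞ :=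
  ENNReal.ofReal (√(1 - ‖x‖ ^ 2 / (k + (m + 2) : ℕ)) ^ m)

theorem measurable_sphereMarginalWeight (k m : ℕ) : Measurable (sphereMarginalWeight k m) := by
  unfold sphereMarginalWeight
  fun_prop

/-- Integrating `φ (√n x' / ‖x‖) h (‖x‖)`, with `x'` the first `k` coordinates of `x`, in polar
coordinates of `ℝⁿ` separates `h` from the spherical average of `φ`. -/
theorem lintegral_sphere_polar {k n : ℕ} (hkn : k ≤ n) (hn : n ≠ 0)
    {φ : EuclideanSpace ℝ (Fin k) → ℝ≥0∞} (hφ : Measurable φ) {h : ℝ → ℝ≥0∞} (hh : Measurable h) :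
    ∫⁻ x : EuclideanSpace ℝ (Fin n), φ ((√(n : ℝ) / ‖x‖) • firstCoords hkn x) * h ‖x‖ =
      (∫⁻ s in Set.Ioi (0 : ℝ), ENNReal.ofReal (s ^ (n - 1)) * h s) *
        ∫⁻ u, φ (√(n : ℝ) • firstCoords hkn (u : EuclideanSpace ℝ (Fin n)))
          ∂(volume : Measure (EuclideanSpace ℝ (Fin n))).toSphere := by
  have : Nonempty (Fin n) := ⟨⟨0, Nat.pos_of_ne_zero hn⟩⟩
  have hfc := measurable_firstCoords hkn
  rw [lintegral_eq_lintegral_toSphere_lintegral_Ioi _ (by fun_prop),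
    ← lintegral_const_mul _ (by fun_prop)]
  refine lintegral_congr fun u ↦ ?_
  rw [← lintegral_mul_const _ (by fun_prop)]
  refine setLIntegral_congr_fun measurableSet_Ioi fun r hr ↦ ?_
  rw [Set.mem_Ioi] at hr
  have hu : ‖(u : EuclideanSpace ℝ (Fin n))‖ = 1 := by simp
  rw [firstCoords_smul, norm_smul, hu, mul_one, Real.norm_of_nonneg hr.le, smul_smul,
    div_mul_cancel₀ _ hr.ne', finrank_euclideanSpace_fin]
  ring

/-- The substitution `x = (√n / s) y` on `ℝᵏ`, with `n = k + m + 2`. -/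
theorem lintegral_scaled_weight {k m : ℕ}
    {φ : EuclideanSpace ℝ (Fin k) → ℝ≥0∞} (hφ : Measurable φ) {s : ℝ} (hs : 0 < s) :
    ∫⁻ y : EuclideanSpace ℝ (Fin k), ENNReal.ofReal (s * √(s ^ 2 - ‖y‖ ^ 2) ^ m) *
        φ ((√((k + (m + 2) : ℕ) : ℝ) / s) • y) =
      ENNReal.ofReal (s ^ (k + (m + 2) - 1)) *
        (ENNReal.ofReal ((√((k + (m + 2) : ℕ) : ℝ) ^ k)⁻¹) *
          ∫⁻ x, sphereMarginalWeight k m x * φ x) := by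
  have hn : (0 : ℝ) < (k + (m + 2) : ℕ) := by positivity
  set N : ℝ := ((k + (m + 2) : ℕ) : ℝ) with hN
  have hW := measurable_sphereMarginalWeight k m
  have ha : 0 < √N / s := by positivity
  have hpt : ∀ y : EuclideanSpace ℝ (Fin k), ENNReal.ofReal (s * √(s ^ 2 - ‖y‖ ^ 2) ^ m) *
        φ ((√N / s) • y) = ENNReal.ofReal (s ^ (m + 1)) *
        (sphereMarginalWeight k m ((√N / s) • y) * φ ((√N / s) • y)) := by
    intro y
    rw [← mul_assoc, sphereMarginalWeight, ← ENNReal.ofReal_mul (by positivity), norm_smul,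
      Real.norm_of_nonneg ha.le, ← hN]
    congr 2
    have h1 : s ^ 2 - ‖y‖ ^ 2 = s ^ 2 * (1 - (√N / s * ‖y‖) ^ 2 / N) := by
      rw [mul_pow, div_pow, Real.sq_sqrt hn.le]
      field_simp
    rw [h1, Real.sqrt_mul (by positivity), Real.sqrt_sq hs.le]
    ring
  simp_rw [hpt]
  rw [lintegral_const_mul _ (by fun_prop),
    lintegral_comp_smul_of_pos _ ha (f := fun x ↦ sphereMarginalWeight k m x * φ x) (by fun_prop),
    ← mul_assoc, ← mul_assoc, ← ENNReal.ofReal_mul (by positivity),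
    ← ENNReal.ofReal_mul (by positivity), finrank_euclideanSpace_fin]
  congr 2
  rw [show k + (m + 2) - 1 = m + 1 + k by omega, div_pow, inv_div, pow_add s (m + 1) k,
    div_eq_mul_inv, mul_assoc]

/-- The integral of `lintegral_sphere_polar`, computed instead with polar coordinates on the last
`m + 2` coordinates only. The factor containing `h` is the same in both results. -/
theorem lintegral_sphere_cylindrical {k m : ℕ} (hm : m ≠ 0) (hkn : k ≤ k + (m + 2))
    {φ : EuclideanSpace ℝ (Fin k) → ℝ≥0∞} (hφ : Measurable φ) {h : ℝ → ℝ≥0∞} (hh : Measurable h) :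
    ∫⁻ x : EuclideanSpace ℝ (Fin (k + (m + 2))),
        φ ((√((k + (m + 2) : ℕ) : ℝ) / ‖x‖) • firstCoords hkn x) * h ‖x‖ =
      (∫⁻ s in Set.Ioi (0 : ℝ), ENNReal.ofReal (s ^ (k + (m + 2) - 1)) * h s) *
        ((volume : Measure (EuclideanSpace ℝ (Fin (m + 2)))).toSphere Set.univ *
          (ENNReal.ofReal ((√((k + (m + 2) : ℕ) : ℝ) ^ k)⁻¹) *
            ∫⁻ x, sphereMarginalWeight k m x * φ x)) := by
  have hfc := measurable_firstCoords hkn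
  set N : ℝ := ((k + (m + 2) : ℕ) : ℝ) with hN
  set σ := (volume : Measure (EuclideanSpace ℝ (Fin (m + 2)))).toSphere Set.univ
  have hz : ∀ y : EuclideanSpace ℝ (Fin k), ∫⁻ z : EuclideanSpace ℝ (Fin (m + 2)),
      φ ((√N / √(‖y‖ ^ 2 + ‖z‖ ^ 2)) • y) * h √(‖y‖ ^ 2 + ‖z‖ ^ 2) =
      σ * ∫⁻ s in Set.Ioi (0 : ℝ), ENNReal.ofReal (s * √(s ^ 2 - ‖y‖ ^ 2) ^ m) *
        (φ ((√N / s) • y) * h s) := by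
    intro y
    rw [lintegral_fun_norm_eq_toSphere_univ_mul _
      (f := fun r ↦ φ ((√N / √(‖y‖ ^ 2 + r ^ 2)) • y) * h √(‖y‖ ^ 2 + r ^ 2)) (by fun_prop),
      finrank_euclideanSpace_fin]
    exact congrArg _ (lintegral_Ioi_comp_sqrt_sq_add_sq (norm_nonneg y) hm
      fun s ↦ φ ((√N / s) • y) * h s)
  rw [← (measurePreserving_appendCoords k (m + 2)).lintegral_comp (by fun_prop),
    Measure.volume_eq_prod, lintegral_prod _ (by
      have := (measurePreserving_appendCoords k (m + 2)).measurable
      fun_prop)]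
  simp_rw [firstCoords_appendCoords, norm_appendCoords, hz]
  rw [lintegral_const_mul _ (by fun_prop), lintegral_lintegral_swap (by fun_prop)]
  rw [mul_left_comm, ← lintegral_mul_const _ (by fun_prop)]
  refine congrArg _ (setLIntegral_congr_fun measurableSet_Ioi fun s hs ↦ ?_)
  simp_rw [← mul_assoc]
  rw [lintegral_mul_const _ (by fun_prop), lintegral_scaled_weight hφ hs]
  ring

/-- The first `k` coordinates of a uniform point of `Sⁿ⁻¹(√n)` have density proportional to
`sphereMarginalWeight`; the normalising constant is expressed through the total mass of the weight. -/
theorem lintegral_uniformSphere_mul {k m : ℕ} (hm : m ≠ 0) (hkn : k ≤ k + (m + 2))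
    {φ : EuclideanSpace ℝ (Fin k) → ℝ≥0∞} (hφ : Measurable φ) :
    (∫⁻ x, φ (firstCoords hkn x) ∂(uniformSphere (k + (m + 2)))) *
        ∫⁻ x, sphereMarginalWeight k m x = ∫⁻ x, sphereMarginalWeight k m x * φ x := by
  set n := k + (m + 2) with hn
  set W := sphereMarginalWeight k m
  have hfc := measurable_firstCoords hkn
  have hn0 : n ≠ 0 := by omega
  set τ := (volume : Measure (EuclideanSpace ℝ (Fin n))).toSphere
  have : Nonempty (Fin n) := ⟨⟨0, Nat.pos_of_ne_zero hn0⟩⟩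
  have hτ0 : τ Set.univ ≠ 0 := by
    rw [Ne, Measure.measure_univ_eq_zero]
    exact Measure.toSphere_ne_zero _
  have hτ : τ Set.univ ≠ ∞ := measure_ne_top _ _
  -- Any radial function whose moment `c` is positive and finite serves; here `c` is `Γ(n)`.
  let h : ℝ → ℝ≥0∞ := fun s ↦ ENNReal.ofReal (Real.exp (-s))
  have hh : Measurable h := by fun_prop
  set c := ∫⁻ s in Set.Ioi (0 : ℝ), ENNReal.ofReal (s ^ (n - 1)) * h s with hc
  have hcval : c = ENNReal.ofReal (Real.Gamma n) := by
    have hpos : (0 : ℝ) < n := by positivity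
    rw [Real.Gamma_eq_integral hpos,
      ofReal_integral_eq_lintegral_ofReal (Real.GammaIntegral_convergent hpos)]
    · refine setLIntegral_congr_fun measurableSet_Ioi fun s hs ↦ ?_
      rw [← ENNReal.ofReal_mul (pow_nonneg (Set.mem_Ioi.1 hs).le _), mul_comm,
        ← Real.rpow_natCast, Nat.cast_sub (by omega), Nat.cast_one]
    · filter_upwards [ae_restrict_mem measurableSet_Ioi] with s hs
      exact mul_nonneg (Real.exp_pos _).le (Real.rpow_nonneg (Set.mem_Ioi.1 hs).le _)
  have hc0 : c ≠ 0 := by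
    rw [hcval, ← pos_iff_ne_zero, ENNReal.ofReal_pos]
    exact Real.Gamma_pos_of_pos (by positivity)
  have hctop : c ≠ ∞ := hcval ▸ ENNReal.ofReal_ne_top
  have key : ∀ {ψ : EuclideanSpace ℝ (Fin k) → ℝ≥0∞}, Measurable ψ →
      ∫⁻ u, ψ (√(n : ℝ) • firstCoords hkn (u : EuclideanSpace ℝ (Fin n))) ∂τ =
      (volume : Measure (EuclideanSpace ℝ (Fin (m + 2)))).toSphere Set.univ *
          (ENNReal.ofReal ((√(n : ℝ) ^ k)⁻¹) * ∫⁻ x, W x * ψ x) := by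
    intro ψ hψ
    have h1 := lintegral_sphere_polar hkn hn0 hψ hh
    rw [lintegral_sphere_cylindrical hm hkn hψ hh] at h1
    exact ((ENNReal.mul_right_inj hc0 hctop).1 h1).symm
  have huni : ∫⁻ x, φ (firstCoords hkn x) ∂(uniformSphere n) = (τ Set.univ)⁻¹ *
      ∫⁻ u, φ (√(n : ℝ) • firstCoords hkn (u : EuclideanSpace ℝ (Fin n))) ∂τ := by
    rw [uniformSphere, lintegral_map (by fun_prop) (measurable_sphereDilation n),
      lintegral_smul_measure]
    rfl
  -- The case `ψ = 1` determines the remaining constants.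
  have h1 := key (ψ := fun _ ↦ 1) measurable_const
  simp only [lintegral_one, mul_one] at h1
  have h2 : (∫⁻ u, φ (√(n : ℝ) • firstCoords hkn (u : EuclideanSpace ℝ (Fin n))) ∂τ) *
      ∫⁻ x, W x = τ Set.univ * ∫⁻ x, W x * φ x := by
    rw [key hφ, h1]
    ring
  rw [huni, mul_assoc, h2, ← mul_assoc, ENNReal.inv_mul_cancel hτ0 hτ, one_mul]

/-! ### Comparison with the Gaussian measure -/

/-- The weight is at most the Gaussian density `exp (-‖x‖² / 2)` times a factor which grows slowly
for large `n`, because `1 - t ≤ exp (-t)`. -/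
theorem sphereMarginalWeight_le (k m : ℕ) (x : EuclideanSpace ℝ (Fin k)) :
    sphereMarginalWeight k m x ≤
      ENNReal.ofReal (Real.exp (-‖x‖ ^ 2 / 2)) *
        ENNReal.ofReal (Real.exp ((k + 2) / (2 * (k + (m + 2) : ℕ)) * ‖x‖ ^ 2)) := by
  have hn : (0 : ℝ) < (k + (m + 2) : ℕ) := by positivity
  rw [← ENNReal.ofReal_mul (Real.exp_pos _).le, ← Real.exp_add, sphereMarginalWeight]
  refine ENNReal.ofReal_le_ofReal ?_
  have h1 : √(1 - ‖x‖ ^ 2 / (k + (m + 2) : ℕ)) ≤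
      Real.exp (-(‖x‖ ^ 2 / (k + (m + 2) : ℕ)) / 2) := by
    rw [Real.exp_half]
    refine Real.sqrt_le_sqrt ?_
    have := Real.add_one_le_exp (-(‖x‖ ^ 2 / (k + (m + 2) : ℕ)))
    linarith
  refine (pow_le_pow_left₀ (Real.sqrt_nonneg _) h1 m).trans_eq ?_
  rw [← Real.exp_nat_mul]
  congr 1
  field_simp
  push_cast
  ring

/-- A lower bound, uniform in `m`, for the total mass of the weight: by Bernoulli's inequality the
weight is at least `1 / 2` on the ball of radius `1 / 2`. -/
theorem half_volume_ball_le_lintegral_sphereMarginalWeight (k m : ℕ) :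
    2⁻¹ * volume (Metric.ball (0 : EuclideanSpace ℝ (Fin k)) (1 / 2)) ≤
      ∫⁻ x, sphereMarginalWeight k m x := by
  have hn : (0 : ℝ) < (k + (m + 2) : ℕ) := by positivity
  rw [← setLIntegral_const]
  refine (setLIntegral_mono (measurable_sphereMarginalWeight k m) fun x hx ↦ ?_).trans
    (setLIntegral_le_lintegral _ _)
  have hhalf : (2 : ℝ≥0∞)⁻¹ = ENNReal.ofReal 2⁻¹ := by
    rw [ENNReal.ofReal_inv_of_pos two_pos, ENNReal.ofReal_ofNat]
  rw [sphereMarginalWeight, hhalf]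
  refine ENNReal.ofReal_le_ofReal ?_
  rw [mem_ball_zero_iff] at hx
  set N : ℝ := ((k + (m + 2) : ℕ) : ℝ) with hN
  have hmN : (m : ℝ) + 2 ≤ N := by rw [hN]; push_cast; linarith [(k.cast_nonneg : (0 : ℝ) ≤ k)]
  have hm : (0 : ℝ) ≤ m := m.cast_nonneg
  have hx1 : ‖x‖ ^ 2 ≤ 1 / 4 := by nlinarith [norm_nonneg x]
  have hx2 : ‖x‖ ^ 2 / N ≤ 1 / (4 * N) := by
    rw [div_le_div_iff₀ hn (by positivity)]
    nlinarith
  have h0 : 0 ≤ 1 / (4 * N) := by positivity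
  have h1 : 1 / (4 * N) ≤ 1 := by rw [div_le_one (by positivity)]; linarith
  have h2 : 1 + -(1 / (4 * N)) ≤ √(1 - ‖x‖ ^ 2 / N) := by
    refine Real.le_sqrt_of_sq_le ?_
    nlinarith
  refine le_trans ?_ (pow_le_pow_left₀ (by linarith) h2 m)
  refine le_trans ?_ (one_add_mul_le_pow (by linarith) m)
  have h3 : m * (1 / (4 * N)) ≤ 1 / 4 := by
    rw [mul_one_div, div_le_div_iff₀ (by positivity) (by norm_num)]
    linarith
  linarith

theorem lintegral_uniformSphere_le_lintegral_stdGaussian {k m : ℕ} (hm : m ≠ 0)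
    (hkn : k ≤ k + (m + 2)) {φ : EuclideanSpace ℝ (Fin k) → ℝ≥0∞} (hφ : Measurable φ) :
    ∫⁻ x, φ (firstCoords hkn x) ∂(uniformSphere (k + (m + 2))) ≤
      ENNReal.ofReal ((2 * Real.pi) ^ (k / 2 : ℝ)) /
          (2⁻¹ * volume (Metric.ball (0 : EuclideanSpace ℝ (Fin k)) (1 / 2))) *
        ∫⁻ x, φ x * ENNReal.ofReal (Real.exp ((k + 2) / (2 * (k + (m + 2) : ℕ)) * ‖x‖ ^ 2))
          ∂(stdGaussian (EuclideanSpace ℝ (Fin k))) := by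
  set V := 2⁻¹ * volume (Metric.ball (0 : EuclideanSpace ℝ (Fin k)) (1 / 2)) with hV
  have hV0 : V ≠ 0 := mul_ne_zero (by simp) (Metric.measure_ball_pos _ _ (by norm_num)).ne'
  have hVtop : V ≠ ∞ := ENNReal.mul_ne_top (by simp) measure_ball_lt_top.ne
  rw [div_eq_mul_inv, mul_right_comm, ← div_eq_mul_inv,
    ENNReal.le_div_iff_mul_le (.inl hV0) (.inl hVtop)]
  calc
    _ ≤ (∫⁻ x, φ (firstCoords hkn x) ∂(uniformSphere (k + (m + 2)))) *
        ∫⁻ x, sphereMarginalWeight k m x := by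
      gcongr
      exact half_volume_ball_le_lintegral_sphereMarginalWeight k m
    _ = ∫⁻ x, sphereMarginalWeight k m x * φ x := lintegral_uniformSphere_mul hm hkn hφ
    _ ≤ ∫⁻ x : EuclideanSpace ℝ (Fin k), ENNReal.ofReal (Real.exp (-‖x‖ ^ 2 / 2)) *
        (φ x * ENNReal.ofReal (Real.exp ((k + 2) / (2 * (k + (m + 2) : ℕ)) * ‖x‖ ^ 2))) := by
      refine lintegral_mono fun x ↦ ?_
      rw [mul_left_comm, ← mul_comm (φ x)]
      gcongr
      exact sphereMarginalWeight_le k m x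
    _ = _ := by
      have h := withDensity_exp_neg_sq_norm_eq_smul_stdGaussian (EuclideanSpace ℝ (Fin k))
      rw [finrank_euclideanSpace_fin] at h
      rw [← smul_eq_mul (ENNReal.ofReal _) (lintegral _ _), ← lintegral_smul_measure, ← h,
        lintegral_withDensity_eq_lintegral_mul _ (by fun_prop) (by fun_prop)]
      rfl

/-- Hölder's inequality applied to `lintegral_uniformSphere_le_lintegral_stdGaussian`. The hypothesis
on `n` makes the `q`-th power of the exponential factor at most `exp (‖x‖² / 8)`. -/
theorem lintegral_uniformSphere_le_Lp_stdGaussian {k n : ℕ} (hkn : k ≤ n) {p q : ℝ}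
    (hpq : p.HolderConjugate q) (hn : 4 * ((k : ℝ) + 2) * q < n)
    {φ : EuclideanSpace ℝ (Fin k) → ℝ≥0∞} (hφ : Measurable φ) :
    ∫⁻ x, φ (firstCoords hkn x) ∂(uniformSphere n) ≤
      ENNReal.ofReal ((2 * Real.pi) ^ (k / 2 : ℝ)) /
          (2⁻¹ * volume (Metric.ball (0 : EuclideanSpace ℝ (Fin k)) (1 / 2))) *
        (∫⁻ x, ENNReal.ofReal (Real.exp (1 / 8 * ‖x‖ ^ 2))
          ∂(stdGaussian (EuclideanSpace ℝ (Fin k)))) ^ (1 / q) *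
        (∫⁻ x, φ x ^ p ∂(stdGaussian (EuclideanSpace ℝ (Fin k)))) ^ (1 / p) := by
  have hq := hpq.symm.lt
  have hq0 := hpq.symm.pos
  have hk : (0 : ℝ) ≤ k := k.cast_nonneg
  obtain ⟨m, hm, rfl⟩ : ∃ m, m ≠ 0 ∧ n = k + (m + 2) := by
    have h1 : (k : ℝ) + 2 < n := by nlinarith
    have h2 : k + 2 < n := by exact_mod_cast h1
    exact ⟨n - k - 2, by omega, by omega⟩
  have hN : (0 : ℝ) < (k + (m + 2) : ℕ) := by positivity
  refine (lintegral_uniformSphere_le_lintegral_stdGaussian hm hkn hφ).trans ?_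
  rw [mul_assoc]
  refine mul_le_mul_right ?_ _
  refine (ENNReal.lintegral_mul_le_Lp_mul_Lq _ hpq hφ.aemeasurable
    (g := fun x ↦ ENNReal.ofReal (Real.exp ((k + 2) / (2 * (k + (m + 2) : ℕ)) * ‖x‖ ^ 2)))
    (by fun_prop)).trans ?_
  rw [mul_comm]
  gcongr with x
  rw [ENNReal.ofReal_rpow_of_pos (Real.exp_pos _), ← Real.exp_mul]
  refine ENNReal.ofReal_le_ofReal (Real.exp_le_exp.2 ?_)
  rw [mul_right_comm]
  gcongr
  rw [div_mul_eq_mul_div, div_le_div_iff₀ (by positivity) (by norm_num)]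
  nlinarith

/-- The law of the first `k` coordinates on the sphere is absolutely continuous with respect to the
Gaussian measure, so that almost everywhere classes may be composed with `firstCoords`. -/
theorem quasiMeasurePreserving_firstCoords_uniformSphere {k n : ℕ} (hkn : k ≤ n) {p q : ℝ}
    (hpq : p.HolderConjugate q) (hn : 4 * ((k : ℝ) + 2) * q < n) :
    Measure.QuasiMeasurePreserving
      (fun x : Metric.sphere (0 : EuclideanSpace ℝ (Fin n)) √(n : ℝ) ↦ firstCoords hkn x)
      (uniformSphere n) (stdGaussian (EuclideanSpace ℝ (Fin k))) := by
  have hfc := measurable_firstCoords hkn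
  refine ⟨by fun_prop, Measure.AbsolutelyContinuous.mk fun s hs h0 ↦ ?_⟩
  have h := lintegral_uniformSphere_le_Lp_stdGaussian hkn hpq hn (φ := s.indicator 1)
    (measurable_one.indicator hs)
  have h1 : ∫⁻ x, s.indicator 1 x ^ p ∂(stdGaussian (EuclideanSpace ℝ (Fin k))) = 0 := by
    rw [lintegral_eq_zero_iff ((measurable_one.indicator hs).pow_const p)]
    filter_upwards [measure_eq_zero_iff_ae_notMem.1 h0] with x hx
    simp [hx, hpq.pos]
  rw [h1, ENNReal.zero_rpow_of_pos (by simpa using hpq.pos), mul_zero, nonpos_iff_eq_zero] at h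
  rw [← lintegral_indicator_one hs, lintegral_map (measurable_one.indicator hs) (by fun_prop)]
  exact h

theorem mainTheorem2 (k : ℕ) (p : ℝ) (hp : 1 < p) :
    ∃ C : ℝ, 0 < C ∧
      ∀ q : ℝ, 0 < q → 1 / p + 1 / q = 1 →
        ∀ g : EuclideanSpace ℝ (Fin k) → ℝ,
          MemLp g (ENNReal.ofReal p) (stdGaussian (EuclideanSpace ℝ (Fin k))) →
          ∀ (n : ℕ) (hkn : k ≤ n), 4 * ((k : ℝ) + 2) * q < (n : ℝ) →
            Integrable
                (fun x : Metric.sphere (0 : EuclideanSpace ℝ (Fin n)) (√(n : ℝ)) =>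
                  |g (firstCoords hkn x)|)
                (uniformSphere n) ∧
              ∫ x : Metric.sphere (0 : EuclideanSpace ℝ (Fin n)) (√(n : ℝ)),
                  |g (firstCoords hkn x)| ∂(uniformSphere n) ≤
                C * (∫ x, |g x| ^ p ∂(stdGaussian (EuclideanSpace ℝ (Fin k)))) ^ (1 / p) := by
  set μ := stdGaussian (EuclideanSpace ℝ (Fin k)) with hμ
  set K := ∫⁻ x : EuclideanSpace ℝ (Fin k), ENNReal.ofReal (Real.exp (1 / 8 * ‖x‖ ^ 2)) ∂μ with hK
  set V := 2⁻¹ * volume (Metric.ball (0 : EuclideanSpace ℝ (Fin k)) (1 / 2)) with hV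
  set A := ENNReal.ofReal ((2 * Real.pi) ^ (k / 2 : ℝ)) / V * K ^ (1 / p.conjExponent) with hA
  have hconj := Real.HolderConjugate.conjExponent hp
  have hV0 : V ≠ 0 := mul_ne_zero (by simp) (Metric.measure_ball_pos _ _ (by norm_num)).ne'
  have hVtop : V ≠ ∞ := ENNReal.mul_ne_top (by simp) measure_ball_lt_top.ne
  have hKtop : K ≠ ∞ := (lintegral_exp_sq_norm_stdGaussian_lt_top _ (by norm_num)).ne
  -- The lower bound on `K` makes the constant `A` positive.
  have hK1 : 1 ≤ K := by
    calc
      (1 : ℝ≥0∞) = ∫⁻ _, 1 ∂μ := by simp [hμ]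
      _ ≤ K := lintegral_mono fun x ↦
        ENNReal.one_le_ofReal.2 (Real.one_le_exp (by positivity))
  have hAtop : A ≠ ∞ := ENNReal.mul_ne_top (ENNReal.div_ne_top ENNReal.ofReal_ne_top hV0)
    (ENNReal.rpow_ne_top_of_nonneg (by have := hconj.symm.pos; positivity) hKtop)
  have hA0 : A ≠ 0 := by
    refine mul_ne_zero (ENNReal.div_ne_zero.2 ⟨?_, hVtop⟩)
      (ENNReal.rpow_pos (one_pos.trans_le hK1) hKtop).ne'
    rw [← pos_iff_ne_zero, ENNReal.ofReal_pos]
    positivity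
  refine ⟨A.toReal, ENNReal.toReal_pos hA0 hAtop, fun q hq hpq g hg n hkn hn ↦ ?_⟩
  have hp0 : 0 < p := one_pos.trans hp
  have hpq' : p.HolderConjugate q :=
    Real.holderConjugate_iff.2 ⟨hp, by simpa using hpq⟩
  obtain rfl : q = p.conjExponent := hpq'.conjugate_eq
  have hqmp := quasiMeasurePreserving_firstCoords_uniformSphere hkn hpq' hn
  have hmeas := hg.1.comp_quasiMeasurePreserving hqmp
  have hgp : Integrable (fun x ↦ |g x| ^ p) μ := by
    have h := hg.integrable_norm_rpow (by simpa using hp0) ENNReal.ofReal_ne_top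
    rwa [ENNReal.toReal_ofReal hp0.le] at h
  have hbound : ∫⁻ x : Metric.sphere (0 : EuclideanSpace ℝ (Fin n)) √(n : ℝ),
      ‖g (firstCoords hkn x)‖ₑ ∂(uniformSphere n) ≤
      A * ENNReal.ofReal (∫ x, |g x| ^ p ∂μ) ^ (1 / p) := by
    -- A measurable representative of `g` gives the same integrals on both sides, since the
    -- marginal of the sphere is absolutely continuous with respect to the Gaussian measure.
    have h1 := lintegral_uniformSphere_le_Lp_stdGaussian hkn hpq' hn
      (φ := fun x ↦ ‖hg.1.mk g x‖ₑ) hg.1.stronglyMeasurable_mk.measurable.enorm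
    have h2 : ∫⁻ x, ‖hg.1.mk g x‖ₑ ^ p ∂μ = ENNReal.ofReal (∫ x, |g x| ^ p ∂μ) := by
      rw [ofReal_integral_eq_lintegral_ofReal hgp (.of_forall fun x ↦ by positivity)]
      refine lintegral_congr_ae ?_
      filter_upwards [hg.1.ae_eq_mk] with x hx
      rw [← hx, ← ENNReal.ofReal_rpow_of_nonneg (abs_nonneg _) hp0.le, Real.enorm_eq_ofReal_abs]
    rw [h2] at h1
    refine le_trans (le_of_eq (lintegral_congr_ae ?_)) h1
    filter_upwards [hqmp.ae_eq_comp hg.1.ae_eq_mk] with x hx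
    exact congrArg _ hx
  have hfin : A * ENNReal.ofReal (∫ x, |g x| ^ p ∂μ) ^ (1 / p) ≠ ∞ :=
    ENNReal.mul_ne_top hAtop (ENNReal.rpow_ne_top_of_nonneg (by positivity) ENNReal.ofReal_ne_top)
  have hint : Integrable (fun x : Metric.sphere (0 : EuclideanSpace ℝ (Fin n)) √(n : ℝ) ↦
      g (firstCoords hkn x)) (uniformSphere n) :=
    ⟨hmeas, hbound.trans_lt (lt_top_iff_ne_top.2 hfin)⟩
  refine ⟨hint.norm, ?_⟩
  have h3 := ENNReal.toReal_mono hfin hbound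
  rw [← integral_norm_eq_lintegral_enorm hint.1, ENNReal.toReal_mul, ← ENNReal.toReal_rpow,
    ENNReal.toReal_ofReal (integral_nonneg fun x ↦ by positivity)] at h3
  exact h3
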